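/- **Programs.** A probabilistic program $\mathcal P$ with real variables $x_1,\dots,x_m$ is given by its probabilistic control flow graph: a finite set $L$ of locations with an initial location $\ell_{\mathrm{init}}$ and a terminal location $\ell_{\mathrm{term}}$, a set $\Xi_{\mathrm{init}}\subseteq\mathbb R^m$ of initial valuations, and transitions $(\ell,\ell')\in L\times L$, at least one leaving each location. Every location is of one of four types: *non-deterministic branching*; *probabilistic branching*, with a probability distribution $Pr_\ell$ on its outgoing transitions; *deterministic*, where the outgoing transitions carry Borel guards that are pairwise disjoint and cover $\mathbb R^m$; or *assignment*, with exactly one outgoing transition, a target variable $x_j$ and an update element $u$, which is a Borel function $u:\mathbb R^m\to\mathbb R$, a probability distribution $d$ on $\mathbb R$, or a Borel set $R\subseteq\mathbb R$ (non-deterministic assignment). A configuration is a pair $(\ell,\mathbf x)\in L\times\mathbb R^m$. Its successors are the $(\ell',\mathbf x')$ such that $(\ell,\ell')$ is a transition, with guard true at $\mathbf x$ if $\ell$ is deterministic, and $\mathbf x'=\mathbf x$ unless $\ell$ is an assignment location, in which case $\mathbf x'=\mathbf x(j\leftarrow a)$ with $a=u(\mathbf x)$, $a\in\operatorname{supp}(d)$,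 or $a\in R$, respectively. Finite paths start in $\{\ell_{\mathrm{init}}\}\times\Xi_{\mathrm{init}}$ and follow successors; a configuration is reachable if a finite path ends in it. A measurable scheduler assigns, measurably, to each finite path ending in a location that is non-deterministic branching or has a non-deterministic assignment a probability distribution on the successors of its last configuration. A measurable scheduler $\sigma$ and $\mathbf x_{\mathrm{init}}\in\Xi_{\mathrm{init}}$ determine a probability measure $\mathbb P^{\sigma}_{\mathbf x_{\mathrm{init}}}$ on runs (infinite sequences of configurations): the run starts in $(\ell_{\mathrm{init}},\mathbf x_{\mathrm{init}})$, and the next configuration is drawn from $\sigma$ in non-deterministic locations, from $Pr_\ell$ in probabilistic branching locations, is given by the only enabled transition in deterministic locations, and is $(\ell',\mathbf x(j\leftarrow a))$ with $a=u(\mathbf x)$, or $a$ sampled from $d$, in the remaining assignment locations. $\mathit{Term}\in\mathbb N_0\cup\{\infty\}$ is the first time at which a run is in $\ell_{\mathrm{term}}$. **LexRSM maps.** An invariant map $I$ assigns to each $\ell$ a Borel set $I(\ell)\subseteq\mathbb R^m$ with $\mathbf x\in I(\ell)$ for every reachable $(\ell,\mathbf x)$. A measurable map $\eta$ assigns to each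 $\ell$ a Borel function $\eta(\ell,\cdot):\mathbb R^m\to\mathbb R$. A generalized transition is a transition whose source is not probabilistic branching, or a probabilistic branching location (outgoing from itself). For $\epsilon\ge 0$ it is $\epsilon$-ranked by $\eta$ from $(\ell,\mathbf x)$ if $E\le\eta(\ell,\mathbf x)-\epsilon$, where $E$ is - $\eta(\ell',\mathbf x)$ for a transition $(\ell,\ell')$ from a deterministic or non-deterministic branching location; - $\sum_{\ell'}Pr_\ell(\ell,\ell')\,\eta(\ell',\mathbf x)$ for a probabilistic branching location $\ell$; - for a transition $(\ell,\ell')$ from an assignment location with target $x_j$: $\eta(\ell',\mathbf x(j\leftarrow u(\mathbf x)))$ for a function $u$; $\mathbb E_{a\sim d}[\eta(\ell',\mathbf x(j\leftarrow a))]$ (required to exist and be finite) for a distribution $d$; $\sup_{a\in R}\eta(\ell',\mathbf x(j\leftarrow a))$ for a set $R$. It is unaffected by $\eta$ if it is $0$-ranked by $\eta$. For $\epsilon>0$, an $n$-dimensional $\epsilon$-LexRSM map for $\mathcal P$ supported by $I$ is a tuple $(\eta_1,\dots,\eta_n)$ of measurable maps such that for all $\ell\ne\ell_{\mathrm{term}}$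 and $\mathbf x\in I(\ell)$: $\eta_j(\ell,\mathbf x)\ge 0$ for all $j$; and for each generalized transition outgoing from $\ell$ (whose guard holds at $\mathbf x$, if $\ell$ is deterministic) there is $j$ such that it is $\epsilon$-ranked by $\eta_j$ from $(\ell,\mathbf x)$ and unaffected by $\eta_{j'}$ from $(\ell,\mathbf x)$ for all $j'<j$. **Theorem.** Let $\mathcal P$ be a probabilistic program. Assume that there exist $\epsilon>0$ and an $n$-dimensional $\epsilon$-LexRSM map for $\mathcal P$ supported by some invariant map. Then $\mathcal P$ terminates almost surely: $\mathbb P^{\sigma}_{\mathbf x_{\mathrm{init}}}(\mathit{Term}<\infty)=1$ for every measurable scheduler $\sigma$ and every $\mathbf x_{\mathrm{init}}\in\Xi_{\mathrm{init}}$. -/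

import Mathlib

open MeasureTheory ProbabilityTheory

/-- Update elements: what an assignment location with `m` program variables assigns to its target
variable. -/
inductive Update (m : ℕ) : Type
  /-- deterministic assignment of a Borel-measurable expression -/
  | fn (u : (Fin m → ℝ) → ℝ) (hu : Measurable u)
  /-- sampling from a probability distribution on the reals -/
  | sample (d : ProbabilityMeasure ℝ)
  /-- non-deterministic choice of a value from a Borel set -/
  | ndet (R : Set ℝ) (hR : MeasurableSet R)

/-- The four types of locations, each with its outgoing transitions and their labels. -/
inductive LocData (L : Type*) (m : ℕ)
  /-- non-deterministic branching; `S` is the non-empty set of targets of outgoing transitions -/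
  | ndBranch (S : Set L) (hS : S.Nonempty)
  /-- probabilistic branching: a discrete distribution on the outgoing transitions -/
  | probBranch (S : Set L) (p : PMF L) (hp : p.support ⊆ S)
  /-- deterministic location: the guards (Borel predicates on valuations) of the outgoing
  transitions are pairwise disjoint and cover all valuations -/
  | det (S : Set L) (G : L → Set (Fin m → ℝ)) (hG : ∀ l ∈ S, MeasurableSet (G l))
      (hex : ∀ x, ∃! l, l ∈ S ∧ x ∈ G l)
  /-- assignment location: its only outgoing transition, the target variable, the update element -/
  | assign (tgt : L) (j : Fin m) (u : Update m)

/-- The set of targets of the transitions outgoing from a location. -/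
def LocData.targets {L : Type*} {m : ℕ} : LocData L m → Set L
  | .ndBranch S _ => S
  | .probBranch S _ _ => S
  | .det S _ _ _ => S
  | .assign tgt _ _ => {tgt}

/-- A location is non-deterministic if it is a non-deterministic branching location or an assignment
location with a non-deterministic assignment. -/
def LocData.IsNondet {L : Type*} {m : ℕ} : LocData L m → Prop
  | .ndBranch _ _ => True
  | .assign _ _ (.ndet _ _) => True
  | _ => False

/-- Probabilistic branching locations. -/
def LocData.IsProbBranch {L : Type*} {m : ℕ} : LocData L m → Prop
  | .probBranch _ _ _ => True
  | _ => False

/-- A probabilistic control flow graph with locations `L` and `m` real program variables, together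
with its terminal location. -/
structure PCFG (L : Type*) (m : ℕ) where
  /-- type, outgoing transitions and labels of each location -/
  loc : L → LocData L m
  /-- initial location -/
  init : L
  /-- terminal location -/
  out : L
  /-- initial valuations -/
  initVal : Set (Fin m → ℝ)

/-- Configurations: a location and a valuation of the program variables. Its sigma-algebra is
generated by the sets `{l} × B` with `B` Borel. -/
abbrev Conf (L : Type*) (m : ℕ) : Type _ := L × (Fin m → ℝ)

/-- Sequences of `i + 1` configurations, indexed by `0, …, i`. -/
abbrev Hist (L : Type*) (m i : ℕ) : Type _ := Finset.Iic i → Conf L m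

/-- The last configuration of a history. -/
def Hist.last {L : Type*} {m i : ℕ} (h : Hist L m i) : Conf L m :=
  h ⟨i, Finset.mem_Iic.2 le_rfl⟩

namespace PCFG

variable {L : Type*} {m : ℕ} (C : PCFG L m)

/-- The transition `(l, l')` exists in the control flow graph. -/
def Trans (l l' : L) : Prop := l' ∈ (C.loc l).targets

/-- The guard of the transition `(l, l')`, true unless `l` is deterministic. -/
def Guard (l l' : L) (x : Fin m → ℝ) : Prop :=
  match C.loc l with
  | .det _ G _ _ => x ∈ G l'
  | _ => True

/-- The valuations that may result from taking a transition out of `l` in valuation `x`. -/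
def NextVal (l : L) (x x' : Fin m → ℝ) : Prop :=
  match C.loc l with
  | .assign _ j (.fn u _) => x' = Function.update x j (u x)
  | .assign _ j (.sample d) => ∃ a ∈ (d : Measure ℝ).support, x' = Function.update x j a
  | .assign _ j (.ndet R _) => ∃ a ∈ R, x' = Function.update x j a
  | _ => x' = x

/-- `c'` is a successor of `c`. -/
def Succ (c c' : Conf L m) : Prop :=
  C.Trans c.1 c'.1 ∧ C.Guard c.1 c'.1 c.2 ∧ C.NextVal c.1 c.2 c'.2

/-- Finite paths (execution fragments) of length `i`. -/
def IsFinitePath {i : ℕ} (h : Hist L m i) : Prop :=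
  (h ⟨0, Finset.mem_Iic.2 (Nat.zero_le i)⟩).1 = C.init ∧
  (h ⟨0, Finset.mem_Iic.2 (Nat.zero_le i)⟩).2 ∈ C.initVal ∧
  ∀ (k : ℕ) (hk : k + 1 ≤ i),
    C.Succ (h ⟨k, Finset.mem_Iic.2 (Nat.le_of_succ_le hk)⟩) (h ⟨k + 1, Finset.mem_Iic.2 hk⟩)

/-- Configurations reachable from some initial configuration. -/
def Reachable (c : Conf L m) : Prop :=
  ∃ (i : ℕ) (h : Hist L m i), C.IsFinitePath h ∧ h.last = c

/-- In a deterministic location, the target of the only enabled transition. -/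
noncomputable def detNext {S : Set L} {G : L → Set (Fin m → ℝ)}
    (hex : ∀ x, ∃! l, l ∈ S ∧ x ∈ G l) (x : Fin m → ℝ) : L := (hex x).choose

lemma measurable_detNext [Fintype L] [MeasurableSpace L] {S : Set L} {G : L → Set (Fin m → ℝ)}
    (hG : ∀ l ∈ S, MeasurableSet (G l)) (hex : ∀ x, ∃! l, l ∈ S ∧ x ∈ G l) :
    Measurable (detNext hex) := by
  intro T _
  have h : detNext hex ⁻¹' T = ⋃ l ∈ T ∩ S, G l := by
    ext x
    have hx := (hex x).choose_spec
    simp only [Set.mem_preimage, Set.mem_iUnion, exists_prop]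
    constructor
    · intro hT
      exact ⟨detNext hex x, ⟨hT, hx.1.1⟩, hx.1.2⟩
    · rintro ⟨l, ⟨hT, hS⟩, hl⟩
      have : l = detNext hex x := hx.2 l ⟨hS, hl⟩
      rwa [← this]
  rw [h]
  exact MeasurableSet.biUnion (Set.to_countable _) fun l hl => hG l hl.2

lemma measurable_update_pair (j : Fin m) :
    Measurable fun z : (Fin m → ℝ) × ℝ => Function.update z.1 j z.2 := by
  refine measurable_pi_iff.2 fun k => ?_
  by_cases h : k = j
  · subst h
    simpa using measurable_snd
  · simp only [Function.update_of_ne h]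
    exact (measurable_pi_apply k).comp measurable_fst

lemma measurable_last [MeasurableSpace L] (i : ℕ) :
    Measurable (Hist.last : Hist L m i → Conf L m) :=
  measurable_pi_apply _

section Semantics

variable [Fintype L] [MeasurableSpace L] [DiscreteMeasurableSpace L]

/-- The distribution of the next configuration from `(l, x)` when `l` is not non-deterministic.
(The value at non-deterministic locations is a dummy: there the scheduler decides.) -/
noncomputable def stepMeasure (l : L) (x : Fin m → ℝ) : Measure (Conf L m) :=
  match C.loc l with
  | .probBranch _ p _ => p.toMeasure.map fun l' => (l', x)
  | .det _ _ _ hex => Measure.dirac (detNext hex x, x)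
  | .assign tgt j (.fn u _) => Measure.dirac (tgt, Function.update x j (u x))
  | .assign tgt j (.sample d) => (d : Measure ℝ).map fun a => (tgt, Function.update x j a)
  | _ => Measure.dirac (l, x)

lemma measurable_stepMeasure (l : L) : Measurable (C.stepMeasure l) := by
  unfold stepMeasure
  split
  · rename_i p _ _
    exact Measurable.map_prodMk_right
  · rename_i hG hex _
    exact Measure.measurable_dirac.comp ((measurable_detNext hG hex).prodMk measurable_id)
  · rename_i tgt j u hu _
    exact Measure.measurable_dirac.comp (measurable_const.prodMk
      ((measurable_update_pair j).comp (measurable_id.prodMk hu)))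
  · rename_i tgt j d _
    have hg : Measurable fun z : (Fin m → ℝ) × ℝ => ((tgt, Function.update z.1 j z.2) : Conf L m) :=
      measurable_const.prodMk (measurable_update_pair j)
    have h : (fun x => (d : Measure ℝ).map
        fun a => ((tgt, Function.update x j a) : Conf L m)) =
        fun x => ((d : Measure ℝ).map (Prod.mk x)).map
          fun z : (Fin m → ℝ) × ℝ => ((tgt, Function.update z.1 j z.2) : Conf L m) := by
      ext1 x
      rw [Measure.map_map hg measurable_prodMk_left]
      rfl
    rw [h]
    exact (Measure.measurable_map _ hg).comp Measurable.map_prodMk_left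
  · exact Measure.measurable_dirac.comp (measurable_const.prodMk measurable_id)

instance isProbabilityMeasure_stepMeasure (l : L) (x : Fin m → ℝ) :
    IsProbabilityMeasure (C.stepMeasure l x) := by
  unfold stepMeasure
  split
  · exact Measure.isProbabilityMeasure_map (by fun_prop)
  · infer_instance
  · infer_instance
  · rename_i tgt j d _
    exact Measure.isProbabilityMeasure_map
      (measurable_const.prodMk (measurable_update_pair j |>.comp
        (measurable_const.prodMk measurable_id))).aemeasurable
  · infer_instance

/-- The step distribution as a kernel on configurations. -/
noncomputable def stepKernel : Kernel (Conf L m) (Conf L m) where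
  toFun c := C.stepMeasure c.1 c.2
  measurable' := measurable_from_prod_countable_right fun l => C.measurable_stepMeasure l

instance : IsMarkovKernel C.stepKernel :=
  ⟨fun c => C.isProbabilityMeasure_stepMeasure c.1 c.2⟩

/-- Measurable schedulers: to every finite path ending in a non-deterministic configuration, a
probability distribution on the successors of that configuration is assigned, measurably in the
path. (The values on all other histories are irrelevant and never used.) -/
structure Scheduler where
  /-- the distribution chosen after a history of length `i` -/
  choice : (i : ℕ) → Kernel (Hist L m i) (Conf L m)
  /-- these are probability distributions -/
  markov : ∀ i, IsMarkovKernel (choice i)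
  /-- the chosen distributions are carried by the successor configurations -/
  succ : ∀ (i : ℕ) (h : Hist L m i), C.IsFinitePath h → (C.loc h.last.1).IsNondet →
    ∀ᵐ c ∂(choice i h), C.Succ h.last c

lemma measurableSet_nondet (i : ℕ) :
    MeasurableSet {h : Hist L m i | (C.loc h.last.1).IsNondet} :=
  (measurable_fst.comp (measurable_last i)) (MeasurableSet.of_discrete
    (s := {l : L | (C.loc l).IsNondet}))

variable {C}

open Classical in
/-- The distribution of the next configuration given the history, under a scheduler. -/
noncomputable def Scheduler.step (σ : C.Scheduler) (i : ℕ) : Kernel (Hist L m i) (Conf L m) :=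
  Kernel.piecewise (C.measurableSet_nondet i) (σ.choice i)
    (C.stepKernel.comap Hist.last (measurable_last i))

instance Scheduler.isMarkovKernel_step (σ : C.Scheduler) (i : ℕ) : IsMarkovKernel (σ.step i) := by
  have := σ.markov i
  unfold Scheduler.step
  infer_instance

/-- The probability measure on runs determined by a scheduler and an initial valuation. -/
noncomputable def Scheduler.runMeasure (σ : C.Scheduler) (x : Fin m → ℝ) :
    Measure (ℕ → Conf L m) :=
  Kernel.traj (X := fun _ => Conf L m) σ.step 0 (fun _ => (C.init, x))

variable (C)

/-- The termination time of a run: the first time at the terminal location, `⊤` if there is none. -/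
noncomputable def termTime (ρ : ℕ → Conf L m) : ℕ∞ :=
  sInf ((fun i : ℕ => (i : ℕ∞)) '' {i | (ρ i).1 = C.out})

/-- Almost-sure termination: under every measurable scheduler and for every initial valuation. -/
def TerminatesAlmostSurely : Prop :=
  ∀ (σ : C.Scheduler), ∀ x ∈ C.initVal, σ.runMeasure x {ρ | C.termTime ρ < ⊤} = 1

end Semantics

/-- Invariant maps: Borel over-approximations of the reachable valuations at each location. -/
structure IsInvariantMap (I : L → Set (Fin m → ℝ)) : Prop where
  measurableSet : ∀ l, MeasurableSet (I l)
  reachable : ∀ c : Conf L m, C.Reachable c → c.2 ∈ I c.1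

/-- Generalized transitions: a transition that does not leave a probabilistic branching location,
or a probabilistic branching location. -/
inductive GenTrans (L : Type*)
  | edge (l l' : L)
  | branch (l : L)

/-- `τ` is a generalized transition of the control flow graph outgoing from location `l`. -/
def Outgoing (l : L) : GenTrans L → Prop
  | .edge l₁ l₂ => l₁ = l ∧ ¬ (C.loc l).IsProbBranch ∧ C.Trans l l₂
  | .branch l₁ => l₁ = l ∧ (C.loc l).IsProbBranch

/-- The guard of a generalized transition. -/
def GenGuard (x : Fin m → ℝ) : GenTrans L → Prop
  | .edge l l' => C.Guard l l' x
  | .branch _ => True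

/-- The generalized transition `τ` is `ε`-ranked by the one-dimensional map `η` from the
configuration given by the source of `τ` and the valuation `x`: the (worst-case) expected value of
`η` after the transition is at most its current value minus `ε`. -/
def Ranked [Fintype L] (η : L → (Fin m → ℝ) → ℝ) (ε : ℝ) (x : Fin m → ℝ) : GenTrans L → Prop
  | .edge l l' =>
    match C.loc l with
    | .ndBranch _ _ => η l' x ≤ η l x - ε
    | .det _ _ _ _ => η l' x ≤ η l x - ε
    | .probBranch _ _ _ => False
    | .assign _ j (.fn u _) => η l' (Function.update x j (u x)) ≤ η l x - ε
    | .assign _ j (.sample d) =>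
        Integrable (fun a => η l' (Function.update x j a)) (d : Measure ℝ) ∧
        (∫ a, η l' (Function.update x j a) ∂(d : Measure ℝ)) ≤ η l x - ε
    | .assign _ j (.ndet R _) =>
        (⨆ a ∈ R, ((η l' (Function.update x j a) : ℝ) : EReal)) ≤ ((η l x - ε : ℝ) : EReal)
  | .branch l =>
    match C.loc l with
    | .probBranch _ p _ => (∑ l', (p l').toReal * η l' x) ≤ η l x - ε
    | _ => False

/-- `η` is an `n`-dimensional lexicographic `ε`-ranking supermartingale map supported by the
invariant map `I`. A transition is unaffected by a map if it is `0`-ranked by it. -/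
structure IsLexRSMMap [Fintype L] (I : L → Set (Fin m → ℝ)) (ε : ℝ) {n : ℕ}
    (η : Fin n → L → (Fin m → ℝ) → ℝ) : Prop where
  measurable : ∀ j l, Measurable (η j l)
  nonneg : ∀ l, l ≠ C.out → ∀ x ∈ I l, ∀ j, 0 ≤ η j l x
  ranked : ∀ l, l ≠ C.out → ∀ x ∈ I l, ∀ τ : GenTrans L, C.Outgoing l τ → C.GenGuard x τ →
    ∃ j, C.Ranked (η j) ε x τ ∧ ∀ j' < j, C.Ranked (η j') 0 x τ

end PCFG

/-!
Fix a scheduler and a run that never reaches the terminal location. Almost surely every step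
`(c, c')` of the run has a level: the index of a component that the step ranks by a fixed `δ`, all
earlier components being unaffected (`PCFG.Scheduler.ae_mem_levelSet`). The levels are well-ordered
and finitely many. If all levels below `k` occur only finitely often, then from some time on
component `k` behaves like a nonnegative supermartingale, which loses `δ` in expectation at each
step of level `k`; hence level `k` occurs only finitely often as well. So no level occurs infinitely
often, which is absurd.

The probabilistic core is `ae_eventually_notMem_of_lintegral_le`. A later component may fail to be
integrable at the time the supermartingale regime starts, and the scheduler may mix steps of
different levels. So the process is started only where its value is bounded by a constant, it is
killed at the first step that leaves the regime, and all expectations are lower Lebesgue integrals.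

A LexRSM map is unconstrained at the terminal location, where it may be negative. This is repaired by
setting it to `0` there and adding, as first component, the indicator of not being terminal
(`PCFG.component`). Any branching that terminates with positive probability is then ranked by the
first component, by an amount bounded below since there are finitely many locations
(`PCFG.exists_pos_le_stepMeasure_out`), and all other steps do not see the change.
-/

open Filter Preorder
open scoped ENNReal NNReal

/-! ### Trajectories of history-dependent kernels -/

section Trajectory

variable {X : Type*} [MeasurableSpace X] {κ : (i : ℕ) → Kernel (Finset.Iic i → X) X}
  [∀ i, IsMarkovKernel (κ i)] {h₀ : Finset.Iic 0 → X}

lemma lintegral_traj_succ {i : ℕ} {F : (Finset.Iic i → X) × X → ℝ≥0∞} (hF : Measurable F) :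
    ∫⁻ ρ, F (frestrictLe i ρ, ρ (i + 1)) ∂(Kernel.traj (X := fun _ => X) κ 0 h₀) =
      ∫⁻ ρ, ∫⁻ c, F (frestrictLe i ρ, c) ∂(κ i (frestrictLe i ρ))
        ∂(Kernel.traj (X := fun _ => X) κ 0 h₀) := by
  have h1 := Kernel.partialTraj_compProd_eq_map_traj (X := fun _ => X) (κ := κ)
    (Nat.zero_le i) (x₀ := h₀)
  have h2 := Kernel.traj_map_frestrictLe_apply (X := fun _ => X) (κ := κ) 0 i h₀
  have hm : Measurable fun ρ : ℕ → X => (frestrictLe (π := fun _ => X) i ρ, ρ (i + 1)) := by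
    fun_prop
  calc _ = ∫⁻ p, F p ∂((Kernel.traj (X := fun _ => X) κ 0 h₀).map
        fun ρ => (frestrictLe i ρ, ρ (i + 1))) := (lintegral_map hF hm).symm
    _ = _ := by
      rw [← h1, Measure.lintegral_compProd hF, ← h2, lintegral_map]
      · exact hF.lintegral_kernel_prod_right'
      · fun_prop

lemma ae_traj_succ {i : ℕ} {Q : (Finset.Iic i → X) → X → Prop}
    (hQ : MeasurableSet {p : (Finset.Iic i → X) × X | Q p.1 p.2})
    (h : ∀ᵐ ρ ∂(Kernel.traj (X := fun _ => X) κ 0 h₀),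
      ∀ᵐ c ∂(κ i (frestrictLe i ρ)), Q (frestrictLe i ρ) c) :
    ∀ᵐ ρ ∂(Kernel.traj (X := fun _ => X) κ 0 h₀), Q (frestrictLe i ρ) (ρ (i + 1)) := by
  have hz := lintegral_traj_succ (κ := κ) (h₀ := h₀)
    ((measurable_const (a := (1 : ℝ≥0∞))).indicator hQ.compl)
  have hr : ∫⁻ ρ, ∫⁻ c, {p : (Finset.Iic i → X) × X | Q p.1 p.2}ᶜ.indicator
      (fun _ => (1 : ℝ≥0∞)) (frestrictLe i ρ, c) ∂(κ i (frestrictLe i ρ))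
        ∂(Kernel.traj (X := fun _ => X) κ 0 h₀) = 0 := by
    refine (lintegral_congr_ae ?_).trans lintegral_zero
    filter_upwards [h] with ρ hρ
    refine (lintegral_congr_ae ?_).trans lintegral_zero
    filter_upwards [hρ] with c hc
    simp [hc]
  rw [hr, lintegral_eq_zero_iff] at hz
  · filter_upwards [hz] with ρ hρ
    by_contra hn
    simp [hn] at hρ
  · exact (measurable_const.indicator hQ.compl).comp (by fun_prop)

lemma ae_traj_zero [MeasurableSingletonClass X] :
    ∀ᵐ ρ ∂(Kernel.traj (X := fun _ => X) κ 0 h₀), ρ 0 = h₀ ⟨0, Finset.mem_Iic.2 le_rfl⟩ := by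
  have h2 := Kernel.traj_map_frestrictLe_apply (X := fun _ => X) (κ := κ) 0 0 h₀
  rw [Kernel.partialTraj_self, Kernel.id_apply] at h2
  have h3 : ∀ᵐ h ∂((Kernel.traj (X := fun _ => X) κ 0 h₀).map (frestrictLe 0)),
      h ⟨0, Finset.mem_Iic.2 le_rfl⟩ = h₀ ⟨0, Finset.mem_Iic.2 le_rfl⟩ := by
    rw [h2, ae_dirac_iff]
    exact measurable_pi_apply (X := fun _ => X) _ (measurableSet_singleton _)
  exact ae_of_ae_map (by fun_prop) h3

/-- Borel-Cantelli for a ranking function that is only controlled while the steps of the trajectory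
stay in `A`. The process `f (ρ i)`, killed at the first step outside `A`, is a nonnegative
supermartingale that loses `ε` in expectation at every step in `B`. -/
lemma ae_eventually_notMem_of_lintegral_le {f : X → ℝ≥0} (hf : Measurable f) {ε : ℝ≥0∞}
    (hε : ε ≠ 0) {A B : Set (X × X)} (hA : MeasurableSet A) (hB : MeasurableSet B)
    (hstep : ∀ (i : ℕ) (h : Finset.Iic i → X),
      ∫⁻ c, A.indicator (fun p => (f p.2 : ℝ≥0∞) + B.indicator (fun _ => ε) p)
        (h ⟨i, Finset.mem_Iic.2 le_rfl⟩, c) ∂(κ i h) ≤ f (h ⟨i, Finset.mem_Iic.2 le_rfl⟩)) :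
    ∀ᵐ ρ ∂(Kernel.traj (X := fun _ => X) κ 0 h₀),
      (∀ᶠ i in atTop, (ρ i, ρ (i + 1)) ∈ A) → ∀ᶠ i in atTop, (ρ i, ρ (i + 1)) ∉ B := by
  set P := Kernel.traj (X := fun _ => X) κ 0 h₀
  -- `E N M i`: from time `N`, where `f` is at most `M`, up to time `N + i` all steps are in `A`.
  let E : ℕ → ℕ → ℕ → Set (ℕ → X) := fun N M i =>
    {ρ | f (ρ N) ≤ M ∧ ∀ t < i, (ρ (N + t), ρ (N + t + 1)) ∈ A}
  have hpair : ∀ {S : Set (X × X)}, MeasurableSet S → ∀ t : ℕ,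
      MeasurableSet {ρ : ℕ → X | (ρ t, ρ (t + 1)) ∈ S} := fun hS t =>
    (show Measurable fun ρ : ℕ → X => (ρ t, ρ (t + 1)) by fun_prop) hS
  have hE : ∀ N M i, MeasurableSet (E N M i) := by
    intro N M i
    refine MeasurableSet.inter ?_ ?_
    · exact measurableSet_le (f := fun ρ : ℕ → X => f (ρ N)) (hf.comp (measurable_pi_apply N))
        measurable_const
    · have : {ρ : ℕ → X | ∀ t < i, (ρ (N + t), ρ (N + t + 1)) ∈ A} =
          ⋂ t ∈ Set.Iio i, {ρ : ℕ → X | (ρ (N + t), ρ (N + t + 1)) ∈ A} := by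
        ext; simp
      change MeasurableSet {ρ : ℕ → X | ∀ t < i, (ρ (N + t), ρ (N + t + 1)) ∈ A}
      rw [this]
      exact MeasurableSet.biInter (Set.to_countable _) fun t _ => hpair hA _
  have hEsucc : ∀ N M i ρ, ρ ∈ E N M (i + 1) ↔
      ρ ∈ E N M i ∧ (ρ (N + i), ρ (N + i + 1)) ∈ A := by
    intro N M i ρ
    constructor
    · rintro ⟨h1, h2⟩
      exact ⟨⟨h1, fun t ht => h2 t (by omega)⟩, h2 i (by omega)⟩
    · rintro ⟨⟨h1, h2⟩, h3⟩
      refine ⟨h1, fun t ht => ?_⟩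
      rcases Nat.lt_succ_iff_lt_or_eq.1 ht with h | rfl
      · exact h2 t h
      · exact h3
  -- Freezing a history at its last entry exhibits `E N M i` as an event of the first `N + i` steps.
  let ext : (n : ℕ) → (Finset.Iic n → X) → ℕ → X := fun n h t =>
    h ⟨min t n, Finset.mem_Iic.2 (min_le_right _ _)⟩
  have hext : ∀ n, Measurable (ext n) := fun n => measurable_pi_iff.2 fun t =>
    measurable_pi_apply _
  have hEext : ∀ N M i ρ, ext (N + i) (frestrictLe (N + i) ρ) ∈ E N M i ↔ ρ ∈ E N M i := by
    intro N M i ρ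
    have he : ∀ t ≤ N + i, ext (N + i) (frestrictLe (N + i) ρ) t = ρ t := by
      intro t ht
      simp [ext, min_eq_left ht]
    simp only [E, Set.mem_ofPred_eq]
    rw [he N (by omega)]
    refine and_congr Iff.rfl (forall₂_congr fun t ht => ?_)
    rw [he (N + t) (by omega), he (N + t + 1) (by omega)]
  let a : ℕ → ℕ → ℕ → ℝ≥0∞ := fun N M i =>
    ∫⁻ ρ, (E N M i).indicator (fun ρ => (f (ρ (N + i)) : ℝ≥0∞)) ρ ∂P
  let S : ℕ → ℕ → ℕ → Set (ℕ → X) := fun N M i =>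
    E N M (i + 1) ∩ {ρ | (ρ (N + i), ρ (N + i + 1)) ∈ B}
  have hfm : ∀ t, Measurable fun ρ : ℕ → X => (f (ρ t) : ℝ≥0∞) := fun t =>
    (hf.comp (measurable_pi_apply t)).coe_nnreal_ennreal
  -- `a N M i` is the expected value of the process killed outside `A`; in one step it drops by at
  -- least `ε` times the probability of an unkilled step in `B`.
  have hdec : ∀ N M i, a N M (i + 1) + ε * P (S N M i) ≤ a N M i := by
    intro N M i
    let G : X × X → ℝ≥0∞ :=
      A.indicator (fun p => (f p.2 : ℝ≥0∞) + B.indicator (fun _ => ε) p)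
    have hG : Measurable G := by
      refine Measurable.indicator ?_ hA
      exact (hf.comp measurable_snd).coe_nnreal_ennreal.add (measurable_const.indicator hB)
    let F : (Finset.Iic (N + i) → X) × X → ℝ≥0∞ := fun q =>
      (E N M i).indicator (fun _ => 1) (ext (N + i) q.1) *
        G (q.1 ⟨N + i, Finset.mem_Iic.2 le_rfl⟩, q.2)
    have hF : Measurable F := by
      refine Measurable.mul ?_ ?_
      · exact (measurable_const.indicator (hE N M i)).comp ((hext _).comp measurable_fst)
      · exact hG.comp (((measurable_pi_apply _).comp measurable_fst).prodMk measurable_snd)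
    have h1 : a N M (i + 1) + ε * P (S N M i) =
        ∫⁻ ρ, F (frestrictLe (N + i) ρ, ρ (N + i + 1)) ∂P := by
      rw [← lintegral_indicator_const ((hE N M (i + 1)).inter (hpair hB _)),
        ← lintegral_add_left ((hfm _).indicator (hE N M (i + 1)))]
      refine lintegral_congr fun ρ => ?_
      have hi : (E N M i).indicator (fun _ => (1 : ℝ≥0∞))
          (ext (N + i) (frestrictLe (N + i) ρ)) = (E N M i).indicator (fun _ => 1) ρ := by
        by_cases h : ρ ∈ E N M i
        · rw [Set.indicator_of_mem h, Set.indicator_of_mem ((hEext N M i ρ).2 h)]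
        · rw [Set.indicator_of_notMem h, Set.indicator_of_notMem (mt (hEext N M i ρ).1 h)]
      simp only [F, hi, G, frestrictLe_apply]
      change _ + (E N M (i + 1) ∩ _).indicator _ ρ = _
      by_cases h2 : (ρ (N + i), ρ (N + i + 1)) ∈ A
      · rw [Set.indicator_of_mem h2]
        by_cases h1 : ρ ∈ E N M i
        · have h4 := (hEsucc N M i ρ).2 ⟨h1, h2⟩
          rw [Set.indicator_of_mem h4, Set.indicator_of_mem h1, one_mul]
          congr 1
          by_cases h3 : (ρ (N + i), ρ (N + i + 1)) ∈ B
          · rw [Set.indicator_of_mem h3, Set.indicator_of_mem (Set.mem_inter h4 h3)]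
          · rw [Set.indicator_of_notMem h3,
              Set.indicator_of_notMem (fun h => h3 h.2)]
        · have h4 : ρ ∉ E N M (i + 1) := fun h => h1 ((hEsucc N M i ρ).1 h).1
          rw [Set.indicator_of_notMem h4, Set.indicator_of_notMem h1,
            Set.indicator_of_notMem (fun h => h4 h.1), add_zero, zero_mul]
      · have h4 : ρ ∉ E N M (i + 1) := fun h => h2 ((hEsucc N M i ρ).1 h).2
        rw [Set.indicator_of_notMem h4, Set.indicator_of_notMem h2,
          Set.indicator_of_notMem (fun h => h4 h.1), add_zero, mul_zero]
    rw [h1, lintegral_traj_succ hF]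
    refine lintegral_mono fun ρ => ?_
    by_cases h : ρ ∈ E N M i
    · have := hstep (N + i) (frestrictLe (N + i) ρ)
      simpa [F, G, Set.indicator_of_mem ((hEext N M i ρ).2 h), Set.indicator_of_mem h] using this
    · simp [F, Set.indicator_of_notMem (mt (hEext N M i ρ).1 h)]
  have hzero : ∀ N M, a N M 0 ≤ M := by
    intro N M
    calc a N M 0 ≤ ∫⁻ _, M ∂P := by
          refine lintegral_mono fun ρ => ?_
          refine Set.indicator_apply_le' (fun h => ?_) fun _ => bot_le
          have h1 : f (ρ N) ≤ M := h.1
          change (f (ρ N) : ℝ≥0∞) ≤ M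
          exact_mod_cast h1
      _ = M := by simp
  have hsum : ∀ N M k, a N M k + ε * ∑ i ∈ Finset.range k, P (S N M i) ≤ M := by
    intro N M k
    induction k with
    | zero => simpa using hzero N M
    | succ k ih =>
      calc _ = (a N M (k + 1) + ε * P (S N M k)) + ε * ∑ i ∈ Finset.range k, P (S N M i) := by
            rw [Finset.sum_range_succ, mul_add]; ring
        _ ≤ _ := (add_le_add_left (hdec N M k) _).trans ih
  have hfin : ∀ N M, ∑' i, P (S N M i) ≠ ∞ := by
    intro N M
    have hle : ε * ∑' i, P (S N M i) ≤ M := by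
      rw [← ENNReal.tsum_mul_left]
      refine ENNReal.tsum_le_of_sum_range_le fun k => ?_
      rw [← Finset.mul_sum]
      exact le_add_self.trans (hsum N M k)
    intro htop
    rw [htop, ENNReal.mul_top hε] at hle
    exact absurd hle (by simp)
  have hbc : ∀ᵐ ρ ∂P, ∀ N M, ∀ᶠ i in atTop, ρ ∉ S N M i :=
    ae_all_iff.2 fun N => ae_all_iff.2 fun M => ae_eventually_notMem (hfin N M)
  filter_upwards [hbc] with ρ hρ hev
  obtain ⟨N, hN⟩ := eventually_atTop.1 hev
  obtain ⟨M, hM⟩ := exists_nat_ge (f (ρ N))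
  obtain ⟨K, hK⟩ := eventually_atTop.1 (hρ N M)
  refine eventually_atTop.2 ⟨N + K, fun i hi hiB => ?_⟩
  obtain ⟨t, rfl⟩ := Nat.exists_eq_add_of_le (show N ≤ i by omega)
  exact hK t (by omega) ⟨⟨hM, fun s _ => hN _ (by omega)⟩, hiB⟩

end Trajectory

namespace PCFG

/-! ### Successors and reachable configurations -/

section Paths

variable {L : Type*} {m : ℕ} {C : PCFG L m}

lemma IsFinitePath.succ_of_succ {i : ℕ} {h : Hist L m (i + 1)}
    (hp : C.IsFinitePath (i := i) fun k => h ⟨k, Finset.mem_Iic.2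
      ((Finset.mem_Iic.1 k.2).trans i.le_succ)⟩)
    (hs : C.Succ (h ⟨i, Finset.mem_Iic.2 i.le_succ⟩) h.last) : C.IsFinitePath h := by
  refine ⟨hp.1, hp.2.1, fun k hk => ?_⟩
  rcases Nat.lt_or_ge k i with hki | hki
  · exact hp.2.2 k hki
  · obtain rfl : k = i := by omega
    exact hs

lemma Reachable.succ {c c' : Conf L m} (hc : C.Reachable c) (hs : C.Succ c c') :
    C.Reachable c' := by
  obtain ⟨i, h, hp, rfl⟩ := hc
  refine ⟨i + 1, fun k => if hk : (k : ℕ) ≤ i then h ⟨k, Finset.mem_Iic.2 hk⟩ else c', ?_, ?_⟩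
  · refine IsFinitePath.succ_of_succ ?_ ?_
    · convert hp using 1
      funext k
      simp [Finset.mem_Iic.1 k.2]
    · simpa [Hist.last] using hs
  · simp [Hist.last]

lemma measurableSet_succ [Fintype L] [MeasurableSpace L] [DiscreteMeasurableSpace L] :
    MeasurableSet {p : Conf L m × Conf L m | C.Succ p.1 p.2} := by
  have hpair : {p : Conf L m × Conf L m | C.Succ p.1 p.2} = ⋃ (l : L) (l' : L),
      {p | p.1.1 = l} ∩ {p | p.2.1 = l'} ∩ {p | C.Trans l l'} ∩
        ({p | C.Trans l l' → C.Guard l l' p.1.2} ∩ {p | C.NextVal l p.1.2 p.2.2}) := by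
    ext ⟨⟨l, x⟩, ⟨l', x'⟩⟩
    simp only [Succ, Set.mem_ofPred_eq, Set.mem_iUnion, Set.mem_inter_iff]
    constructor
    · rintro ⟨h1, h2, h3⟩
      exact ⟨l, l', ⟨⟨⟨rfl, rfl⟩, h1⟩, fun _ => h2, h3⟩⟩
    · rintro ⟨_, _, ⟨⟨⟨rfl, rfl⟩, h1⟩, h2, h3⟩⟩
      exact ⟨h1, h2 h1, h3⟩
  have hx : Measurable fun p : Conf L m × Conf L m => p.1.2 :=
    measurable_snd.comp measurable_fst
  have hx' : Measurable fun p : Conf L m × Conf L m => p.2.2 :=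
    measurable_snd.comp measurable_snd
  -- An existentially quantified value assigned to `x j` can be read off the new valuation.
  have hset : ∀ (j : Fin m) {R : Set ℝ}, MeasurableSet R → MeasurableSet
      {p : Conf L m × Conf L m | ∃ a ∈ R, p.2.2 = Function.update p.1.2 j a} := by
    intro j R hR
    have : {p : Conf L m × Conf L m | ∃ a ∈ R, p.2.2 = Function.update p.1.2 j a} =
        {p | p.2.2 j ∈ R} ∩ {p | p.2.2 = Function.update p.1.2 j (p.2.2 j)} := by
      ext p
      constructor
      · rintro ⟨a, ha, hp⟩
        have : p.2.2 j = a := by rw [hp, Function.update_self]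
        exact ⟨by simpa [this] using ha, by simpa [this] using hp⟩
      · rintro ⟨h1, h2⟩
        exact ⟨_, h1, h2⟩
    rw [this]
    have hj : Measurable fun p : Conf L m × Conf L m => p.2.2 j :=
      (measurable_pi_apply j).comp hx'
    exact (hj hR).inter
      (measurableSet_eq_fun hx' ((measurable_update_pair j).comp (hx.prodMk hj)))
  rw [hpair]
  refine MeasurableSet.iUnion fun l => MeasurableSet.iUnion fun l' => ?_
  have hl : MeasurableSet {p : Conf L m × Conf L m | p.1.1 = l} :=
    (measurable_fst.comp measurable_fst) (MeasurableSet.of_discrete (s := {l}))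
  have hl' : MeasurableSet {p : Conf L m × Conf L m | p.2.1 = l'} :=
    (measurable_fst.comp measurable_snd) (MeasurableSet.of_discrete (s := {l'}))
  refine ((hl.inter hl').inter (MeasurableSet.const _)).inter (MeasurableSet.inter ?_ ?_)
  · by_cases ht : C.Trans l l'
    · simp only [ht, true_imp_iff]
      unfold Trans at ht
      unfold Guard
      cases hloc : C.loc l with
      | det S G hG hex =>
        rw [hloc] at ht
        exact hx (hG l' ht)
      | _ => exact MeasurableSet.univ
    · simp [ht]
  · have heq : MeasurableSet {p : Conf L m × Conf L m | p.2.2 = p.1.2} :=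
      measurableSet_eq_fun hx' hx
    unfold NextVal
    cases hloc : C.loc l with
    | assign t j u =>
      cases u with
      | fn u hu =>
        exact measurableSet_eq_fun hx' ((measurable_update_pair j).comp (hx.prodMk (hu.comp hx)))
      | sample d => exact hset j Measure.isClosed_support.measurableSet
      | ndet R hR => exact hset j hR
    | _ => exact heq

/-- At a non-deterministic location, a ranked transition decreases the map for every successor along
it, whatever the scheduler does. -/
lemma Ranked.le_of_succ [Fintype L] {η : L → (Fin m → ℝ) → ℝ} {e : ℝ} {c c' : Conf L m}
    (hl : (C.loc c.1).IsNondet) (hs : C.Succ c c')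
    (hr : C.Ranked η e c.2 (.edge c.1 c'.1)) : η c'.1 c'.2 ≤ η c.1 c.2 - e := by
  obtain ⟨-, -, hv⟩ := hs
  unfold NextVal at hv
  unfold Ranked at hr
  cases hloc : C.loc c.1 with
  | ndBranch S hS =>
    simp only [hloc] at hr hv
    rwa [hv]
  | assign t j u =>
    cases u with
    | ndet R hR =>
      simp only [hloc] at hr hv
      obtain ⟨a, ha, hv⟩ := hv
      rw [hv]
      exact EReal.coe_le_coe_iff.1 ((le_iSup₂ (f := fun (a : ℝ) (_ : a ∈ R) =>
        ((η c'.1 (Function.update c.2 j a) : ℝ) : EReal)) a ha).trans hr)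
    | _ => simp [hloc, LocData.IsNondet] at hl
  | _ => simp [hloc, LocData.IsNondet] at hl

end Paths

/-! ### The step distribution -/

section Steps

lemma detNext_spec {L : Type*} {m : ℕ} {S : Set L} {G : L → Set (Fin m → ℝ)}
    (hex : ∀ x, ∃! l, l ∈ S ∧ x ∈ G l) (x : Fin m → ℝ) :
    detNext hex x ∈ S ∧ x ∈ G (detNext hex x) := (hex x).choose_spec.1

lemma measurable_prodMk_update {L : Type*} {m : ℕ} [MeasurableSpace L] (l : L) (x : Fin m → ℝ)
    (j : Fin m) : Measurable fun a : ℝ => ((l, Function.update x j a) : Conf L m) :=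
  measurable_const.prodMk ((measurable_update_pair j).comp (measurable_const.prodMk measurable_id))

variable {L : Type*} {m : ℕ} [Fintype L] [MeasurableSpace L] [DiscreteMeasurableSpace L]
  {C : PCFG L m}

lemma ae_succ_stepMeasure {l : L} (x : Fin m → ℝ) (hl : ¬ (C.loc l).IsNondet) :
    ∀ᵐ c ∂(C.stepMeasure l x), C.Succ (l, x) c := by
  have hms : MeasurableSet {c : Conf L m | C.Succ (l, x) c} :=
    measurable_prodMk_left (C.measurableSet_succ)
  cases hloc : C.loc l with
  | ndBranch S hS => simp [hloc, LocData.IsNondet] at hl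
  | probBranch S p hp =>
    simp only [stepMeasure, hloc]
    rw [ae_map_iff (by fun_prop) hms]
    have : ∀ᵐ l' ∂p.toMeasure, l' ∈ p.support := by
      rw [ae_iff, PMF.toMeasure_apply_eq_zero_iff _ MeasurableSet.of_discrete]
      exact Set.disjoint_left.2 fun l' h1 h2 => h2 h1
    filter_upwards [this] with l' hl'
    refine ⟨?_, ?_, ?_⟩
    · simpa [Trans, hloc, LocData.targets] using hp hl'
    · simp [Guard, hloc]
    · simp [NextVal, hloc]
  | det S G hG hex =>
    simp only [stepMeasure, hloc]
    rw [ae_dirac_iff hms]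
    exact ⟨by simpa [Trans, hloc, LocData.targets] using (detNext_spec hex x).1,
      by simpa [Guard, hloc] using (detNext_spec hex x).2, by simp [NextVal, hloc]⟩
  | assign t j u =>
    cases u with
    | fn u hu =>
      simp only [stepMeasure, hloc]
      rw [ae_dirac_iff hms]
      exact ⟨by simp [Trans, hloc, LocData.targets], by simp [Guard, hloc],
        by simp [NextVal, hloc]⟩
    | sample d =>
      simp only [stepMeasure, hloc]
      rw [ae_map_iff (measurable_prodMk_update t x j).aemeasurable hms]
      filter_upwards [Measure.support_mem_ae (μ := (d : Measure ℝ))] with a ha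
      refine ⟨by simp [Trans, hloc, LocData.targets], by simp [Guard, hloc], ?_⟩
      simpa [NextVal, hloc] using ⟨a, ha, rfl⟩
    | ndet R hR => simp [hloc, LocData.IsNondet] at hl

/-- Outside the non-deterministic locations, the probability of moving to the terminal location
does not become arbitrarily small without being zero: it is `0` or `1`, except for the finitely many
probabilistic branchings, where it does not depend on the valuation. -/
lemma exists_pos_le_stepMeasure_out (C : PCFG L m) : ∃ δ : ℝ≥0∞, 0 < δ ∧ δ ≤ 1 ∧
    ∀ (l : L) (x : Fin m → ℝ), ¬ (C.loc l).IsNondet →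
      C.stepMeasure l x {c | c.1 = C.out} = 0 ∨ δ ≤ C.stepMeasure l x {c | c.1 = C.out} := by
  have hO : MeasurableSet {c : Conf L m | c.1 = C.out} :=
    measurable_fst (MeasurableSet.of_discrete (s := {C.out}))
  have key : ∀ l : L, ∃ δ : ℝ≥0∞, 0 < δ ∧ ∀ x : Fin m → ℝ, ¬ (C.loc l).IsNondet →
      C.stepMeasure l x {c | c.1 = C.out} = 0 ∨ δ ≤ C.stepMeasure l x {c | c.1 = C.out} := by
    intro l
    cases hloc : C.loc l with
    | ndBranch S hS => exact ⟨1, one_pos, fun x h => absurd trivial h⟩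
    | probBranch S p hp =>
      have hm : ∀ x : Fin m → ℝ, C.stepMeasure l x {c | c.1 = C.out} = p C.out := by
        intro x
        simp only [stepMeasure, hloc]
        rw [Measure.map_apply (by fun_prop) hO]
        exact p.toMeasure_apply_singleton _ (MeasurableSet.of_discrete)
      rcases eq_or_ne (p C.out) 0 with h0 | h0
      · exact ⟨1, one_pos, fun x _ => Or.inl (by rw [hm, h0])⟩
      · exact ⟨p C.out, pos_iff_ne_zero.2 h0, fun x _ => Or.inr (by rw [hm])⟩
    | det S G hG hex =>
      refine ⟨1, one_pos, fun x _ => ?_⟩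
      simp only [stepMeasure, hloc, Measure.dirac_apply' _ hO]
      by_cases h : detNext hex x = C.out <;> simp [h]
    | assign t j u =>
      refine ⟨1, one_pos, fun x hn => ?_⟩
      cases u with
      | fn u hu =>
        simp only [stepMeasure, hloc, Measure.dirac_apply' _ hO]
        by_cases h : t = C.out <;> simp [h]
      | sample d =>
        simp only [stepMeasure, hloc]
        rw [Measure.map_apply (measurable_prodMk_update t x j) hO]
        by_cases h : t = C.out <;> simp [h]
      | ndet R hR => exact absurd trivial hn
  choose δ hδ hδ' using key
  refine ⟨min 1 (Finset.univ.inf δ), ?_, min_le_left _ _, fun l x hl => ?_⟩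
  · exact lt_min one_pos ((Finset.lt_inf_iff (by simp)).2 fun l _ => hδ l)
  · exact (hδ' l x hl).imp_right fun h =>
      ((min_le_right _ _).trans (Finset.inf_le (Finset.mem_univ l))).trans h

/-- At a location that is not non-deterministic there is a unique enabled generalized transition,
and being ranked along it is a bound on the expectation under the step distribution. -/
lemma exists_genTrans_integral_le {l : L} (x : Fin m → ℝ) (hl : ¬ (C.loc l).IsNondet) :
    ∃ τ : GenTrans L, C.Outgoing l τ ∧ C.GenGuard x τ ∧
      ∀ (η : L → (Fin m → ℝ) → ℝ) (e : ℝ), (∀ l, Measurable (η l)) → C.Ranked η e x τ →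
        Integrable (fun c : Conf L m => η c.1 c.2) (C.stepMeasure l x) ∧
          ∫ c, η c.1 c.2 ∂(C.stepMeasure l x) ≤ η l x - e := by
  have hηm : ∀ (η : L → (Fin m → ℝ) → ℝ), (∀ l, Measurable (η l)) →
      Measurable fun c : Conf L m => η c.1 c.2 := fun η h => measurable_from_prod_countable_right h
  cases hloc : C.loc l with
  | ndBranch S hS => simp [hloc, LocData.IsNondet] at hl
  | probBranch S p hp =>
    refine ⟨.branch l, ⟨rfl, by simp [hloc, LocData.IsProbBranch]⟩, trivial, fun η e hη hr => ?_⟩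
    simp only [Ranked, hloc] at hr
    simp only [stepMeasure, hloc]
    have hm : Measurable fun l' : L => ((l', x) : Conf L m) := by fun_prop
    rw [integrable_map_measure (hηm η hη).aestronglyMeasurable hm.aemeasurable,
      integral_map hm.aemeasurable (hηm η hη).aestronglyMeasurable]
    refine ⟨Integrable.of_finite, ?_⟩
    rw [PMF.integral_eq_sum]
    simpa using hr
  | det S G hG hex =>
    refine ⟨.edge l (detNext hex x), ⟨rfl, by simp [hloc, LocData.IsProbBranch], ?_⟩, ?_,
      fun η e hη hr => ?_⟩
    · simpa [Trans, hloc, LocData.targets] using (detNext_spec hex x).1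
    · simpa [GenGuard, Guard, hloc] using (detNext_spec hex x).2
    · simp only [Ranked, hloc] at hr
      simp only [stepMeasure, hloc]
      rw [integral_dirac' _ _ (hηm η hη).stronglyMeasurable]
      exact ⟨integrable_dirac' (hηm η hη).stronglyMeasurable (by simp), hr⟩
  | assign t j u =>
    refine ⟨.edge l t, ⟨rfl, by simp [hloc, LocData.IsProbBranch],
      by simp [Trans, hloc, LocData.targets]⟩, by simp [GenGuard, Guard, hloc],
      fun η e hη hr => ?_⟩
    cases u with
    | fn u hu =>
      simp only [Ranked, hloc] at hr
      simp only [stepMeasure, hloc]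
      rw [integral_dirac' _ _ (hηm η hη).stronglyMeasurable]
      exact ⟨integrable_dirac' (hηm η hη).stronglyMeasurable (by simp), hr⟩
    | sample d =>
      simp only [Ranked, hloc] at hr
      simp only [stepMeasure, hloc]
      have hm := measurable_prodMk_update t x j
      rw [integrable_map_measure (hηm η hη).aestronglyMeasurable hm.aemeasurable,
        integral_map hm.aemeasurable (hηm η hη).aestronglyMeasurable]
      exact hr
    | ndet R hR => simp [hloc, LocData.IsNondet] at hl

end Steps

/-! ### Levels of steps -/

section Components

variable {L : Type*} {m n : ℕ} {C : PCFG L m}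

/-- The components of `η`, made nonnegative and set to `0` at the terminal location, preceded by the
indicator of not being at the terminal location. A LexRSM map may take arbitrary values at the
terminal location, and a branching could be ranked only thanks to a very negative one; the extra
component ranks all steps that reach the terminal location with positive probability. -/
noncomputable def component (C : PCFG L m) (η : Fin n → L → (Fin m → ℝ) → ℝ) (k : Fin (n + 1)) :
    Conf L m → ℝ≥0 :=
  {c : Conf L m | c.1 ≠ C.out}.indicator
    (Fin.cons (α := fun _ => Conf L m → ℝ≥0) 1 (fun j c => (η j c.1 c.2).toNNReal) k)

lemma component_out (η : Fin n → L → (Fin m → ℝ) → ℝ) (k : Fin (n + 1)) {c : Conf L m}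
    (hc : c.1 = C.out) : C.component η k c = 0 :=
  Set.indicator_of_notMem (by simpa using hc) _

lemma component_zero_of_ne (η : Fin n → L → (Fin m → ℝ) → ℝ) {c : Conf L m} (hc : c.1 ≠ C.out) :
    C.component η 0 c = 1 :=
  Set.indicator_of_mem (s := {c : Conf L m | c.1 ≠ C.out}) hc _

lemma component_succ_of_ne (η : Fin n → L → (Fin m → ℝ) → ℝ) (j : Fin n) {c : Conf L m}
    (hc : c.1 ≠ C.out) : C.component η j.succ c = (η j c.1 c.2).toNNReal :=
  Set.indicator_of_mem (s := {c : Conf L m | c.1 ≠ C.out}) hc _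

lemma component_succ_le (η : Fin n → L → (Fin m → ℝ) → ℝ) (j : Fin n) (c : Conf L m) :
    C.component η j.succ c ≤ (η j c.1 c.2).toNNReal :=
  Set.indicator_apply_le' (fun _ => le_rfl) fun _ => bot_le

end Components

section Levels

variable {L : Type*} {m n : ℕ} [Fintype L] [MeasurableSpace L] [DiscreteMeasurableSpace L]
  {C : PCFG L m}

/-- The steps `(c, c')` along which `g` drops by `δ`: at the step itself if the scheduler chooses
`c'`, and in expectation over the step distribution at `c` otherwise. Unlike `PCFG.Ranked`, this is a
measurable condition, also for non-deterministic assignments. -/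
def rankSet (C : PCFG L m) (g : Conf L m → ℝ≥0) (δ : ℝ≥0∞) : Set (Conf L m × Conf L m) :=
  {p | ((C.loc p.1.1).IsNondet → (g p.2 : ℝ≥0∞) + δ ≤ g p.1) ∧
    (¬ (C.loc p.1.1).IsNondet → ∫⁻ c, g c ∂(C.stepKernel p.1) + δ ≤ g p.1)}

lemma measurableSet_rankSet {g : Conf L m → ℝ≥0} (hg : Measurable g) (δ : ℝ≥0∞) :
    MeasurableSet (C.rankSet g δ) := by
  have hN : MeasurableSet {p : Conf L m × Conf L m | (C.loc p.1.1).IsNondet} :=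
    (measurable_fst.comp measurable_fst)
      (MeasurableSet.of_discrete (s := {l : L | (C.loc l).IsNondet}))
  have h1 : Measurable fun p : Conf L m × Conf L m => (g p.1 : ℝ≥0∞) :=
    (hg.comp measurable_fst).coe_nnreal_ennreal
  have h2 : Measurable fun p : Conf L m × Conf L m => (g p.2 : ℝ≥0∞) :=
    (hg.comp measurable_snd).coe_nnreal_ennreal
  have h3 : Measurable fun p : Conf L m × Conf L m => ∫⁻ c, g c ∂(C.stepKernel p.1) :=
    hg.coe_nnreal_ennreal.lintegral_kernel.comp measurable_fst
  exact (hN.imp (measurableSet_le (h2.add_const δ) h1)).inter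
    (hN.compl.imp (measurableSet_le (h3.add_const δ) h1))

lemma rankSet_anti (g : Conf L m → ℝ≥0) {δ δ' : ℝ≥0∞} (h : δ ≤ δ') :
    C.rankSet g δ' ⊆ C.rankSet g δ := fun _ hp =>
  ⟨fun hn => (add_le_add_right h _).trans (hp.1 hn),
    fun hn => (add_le_add_right h _).trans (hp.2 hn)⟩

/-- The component `g` is a supermartingale as long as it is not increased by the steps taken. The
membership of a step in `rankSet` depends on the successor at non-deterministic locations, where the
bound is pointwise, and on the current configuration alone elsewhere. -/
lemma lintegral_step_rankSet_le (σ : C.Scheduler) (g : Conf L m → ℝ≥0)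
    (δ : ℝ≥0∞) (i : ℕ) (h : Hist L m i) :
    ∫⁻ c, (C.rankSet g 0).indicator
      (fun p => (g p.2 : ℝ≥0∞) + (C.rankSet g δ).indicator (fun _ => δ) p) (h.last, c)
        ∂(σ.step i h) ≤ g h.last := by
  by_cases hn : (C.loc h.last.1).IsNondet
  · calc _ ≤ ∫⁻ _, (g h.last : ℝ≥0∞) ∂(σ.step i h) := by
          refine lintegral_mono fun c => Set.indicator_apply_le' (fun h0 => ?_) fun _ => bot_le
          by_cases hδ : (h.last, c) ∈ C.rankSet g δ
          · simpa [Set.indicator_of_mem hδ] using hδ.1 hn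
          · simpa [Set.indicator_of_notMem hδ] using h0.1 hn
      _ = _ := by simp
  · have hs : σ.step i h = C.stepKernel h.last := by
      simp [Scheduler.step, Kernel.piecewise_apply, hn]
    rw [hs]
    by_cases hδ : ∫⁻ c, g c ∂(C.stepKernel h.last) + δ ≤ g h.last
    · calc _ ≤ ∫⁻ c, ((g c : ℝ≥0∞) + δ) ∂(C.stepKernel h.last) := by
            refine lintegral_mono fun c => Set.indicator_apply_le' (fun _ => ?_) fun _ => bot_le
            exact add_le_add_right (Set.indicator_apply_le' (fun _ => le_rfl) fun _ => bot_le) _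
        _ = ∫⁻ c, g c ∂(C.stepKernel h.last) + δ := by
            rw [lintegral_add_right _ measurable_const]; simp
        _ ≤ _ := hδ
    · by_cases h0 : ∫⁻ c, g c ∂(C.stepKernel h.last) ≤ g h.last
      · refine (lintegral_mono fun c => ?_).trans h0
        refine Set.indicator_apply_le' (fun _ => ?_) fun _ => bot_le
        have : (h.last, c) ∉ C.rankSet g δ := fun hc => hδ (hc.2 hn)
        simp [Set.indicator_of_notMem this]
      · refine (lintegral_mono (g := fun _ => 0) fun c => ?_).trans (by simp)
        have : (h.last, c) ∉ C.rankSet g 0 := fun hc => h0 (by simpa using hc.2 hn)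
        simp [Set.indicator_of_notMem this]

/-- The steps ranked by component `k` and unaffected by the components before it. -/
def levelSet (C : PCFG L m) (η : Fin n → L → (Fin m → ℝ) → ℝ) (δ : ℝ≥0∞) (k : Fin (n + 1)) :
    Set (Conf L m × Conf L m) :=
  C.rankSet (C.component η k) δ ∩ ⋂ j < k, C.rankSet (C.component η j) 0

lemma measurable_component {η : Fin n → L → (Fin m → ℝ) → ℝ} (hη : ∀ j l, Measurable (η j l))
    (k : Fin (n + 1)) : Measurable (C.component η k) := by
  refine Measurable.indicator ?_
    (measurable_fst (MeasurableSet.of_discrete (s := {l : L | l ≠ C.out})))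
  refine Fin.cases ?_ (fun j => ?_) k
  · exact measurable_const
  · have : Measurable fun c : Conf L m => η j c.1 c.2 :=
      measurable_from_prod_countable_right (hη j)
    exact this.real_toNNReal

lemma measurableSet_levelSet {η : Fin n → L → (Fin m → ℝ) → ℝ} (hη : ∀ j l, Measurable (η j l))
    (δ : ℝ≥0∞) (k : Fin (n + 1)) : MeasurableSet (C.levelSet η δ k) :=
  (measurableSet_rankSet (measurable_component hη k) δ).inter
    (MeasurableSet.biInter (Set.to_countable _) fun j _ =>
      measurableSet_rankSet (measurable_component hη j) 0)

lemma mem_levelSet_succ {η : Fin n → L → (Fin m → ℝ) → ℝ} {δ : ℝ≥0∞} {j : Fin n}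
    {p : Conf L m × Conf L m} (hj : p ∈ C.rankSet (C.component η j.succ) δ)
    (h0 : p ∈ C.rankSet (C.component η 0) 0)
    (hlt : ∀ i < j, p ∈ C.rankSet (C.component η i.succ) 0) : p ∈ C.levelSet η δ j.succ := by
  refine ⟨hj, Set.mem_iInter₂.2 fun i => ?_⟩
  refine Fin.cases (fun _ => h0) (fun i hi => hlt i (Fin.succ_lt_succ_iff.1 hi)) i

lemma mem_levelSet_zero {η : Fin n → L → (Fin m → ℝ) → ℝ} {δ : ℝ≥0∞}
    {p : Conf L m × Conf L m} (h : p ∈ C.rankSet (C.component η 0) δ) :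
    p ∈ C.levelSet η δ 0 :=
  ⟨h, Set.mem_iInter₂.2 fun i hi => absurd hi (Fin.not_lt_zero i)⟩

/-- At a non-deterministic location, every successor is reached by a step that has a level. -/
lemma mem_levelSet_of_succ {I : L → Set (Fin m → ℝ)} {η : Fin n → L → (Fin m → ℝ) → ℝ} {ε : ℝ}
    (hε : 0 ≤ ε) (hI : C.IsInvariantMap I) (hη : C.IsLexRSMMap I ε η) {δ : ℝ≥0∞} (hδ1 : δ ≤ 1)
    (hδε : δ ≤ ENNReal.ofReal ε) {c c' : Conf L m} (hc : C.Reachable c) (hout : c.1 ≠ C.out)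
    (hn : (C.loc c.1).IsNondet) (hs : C.Succ c c') : ∃ k, (c, c') ∈ C.levelSet η δ k := by
  by_cases ho : c'.1 = C.out
  · refine ⟨0, mem_levelSet_zero ⟨fun _ => ?_, fun h => absurd hn h⟩⟩
    simpa [component_out η 0 ho, component_zero_of_ne η hout] using hδ1
  have hnb : ¬ (C.loc c.1).IsProbBranch := by
    intro h
    cases hloc : C.loc c.1 <;> simp [hloc, LocData.IsProbBranch, LocData.IsNondet] at h hn
  obtain ⟨j, hj, hlt⟩ := hη.ranked c.1 hout c.2 (hI.reachable c hc) (.edge c.1 c'.1)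
    ⟨rfl, hnb, hs.1⟩ hs.2.1
  have hnonneg : ∀ j, 0 ≤ η j c'.1 c'.2 :=
    hη.nonneg c'.1 ho c'.2 (hI.reachable c' (hc.succ hs))
  have key : ∀ (i : Fin n) (e : ℝ), 0 ≤ e → C.Ranked (η i) e c.2 (.edge c.1 c'.1) →
      (c, c') ∈ C.rankSet (C.component η i.succ) (ENNReal.ofReal e) := by
    intro i e he hr
    refine ⟨fun _ => ?_, fun h => absurd hn h⟩
    have := hr.le_of_succ hn hs
    change ((C.component η i.succ c' : ℝ≥0) : ℝ≥0∞) + _ ≤ (C.component η i.succ c : ℝ≥0)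
    rw [component_succ_of_ne η i ho, component_succ_of_ne η i hout]
    change ENNReal.ofReal _ + _ ≤ ENNReal.ofReal _
    rw [← ENNReal.ofReal_add (hnonneg i) he]
    exact ENNReal.ofReal_le_ofReal (by linarith)
  refine ⟨j.succ, mem_levelSet_succ (rankSet_anti _ hδε (key j ε hε hj)) ?_ fun i hi => ?_⟩
  · refine ⟨fun _ => ?_, fun h => absurd hn h⟩
    simp [component_zero_of_ne η ho, component_zero_of_ne η hout]
  · simpa using key i 0 le_rfl (hlt i hi)

/-- Elsewhere the level is determined by the configuration. It is `0` if the terminal location is hit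
with positive probability; otherwise the values of `η` at the terminal location are irrelevant, and
the level is the one provided by `η`. -/
lemma exists_mem_levelSet_of_not_isNondet {I : L → Set (Fin m → ℝ)}
    {η : Fin n → L → (Fin m → ℝ) → ℝ} {ε : ℝ}
    (hε : 0 ≤ ε) (hI : C.IsInvariantMap I) (hη : C.IsLexRSMMap I ε η) {δ : ℝ≥0∞}
    (hδε : δ ≤ ENNReal.ofReal ε)
    {c : Conf L m} (hc : C.Reachable c) (hout : c.1 ≠ C.out)
    (hn : ¬ (C.loc c.1).IsNondet)
    (hδ : C.stepKernel c {c | c.1 = C.out} = 0 ∨ δ ≤ C.stepKernel c {c | c.1 = C.out}) :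
    ∃ k, ∀ c', (c, c') ∈ C.levelSet η δ k := by
  have hO : MeasurableSet {c : Conf L m | c.1 = C.out} :=
    measurable_fst (MeasurableSet.of_discrete (s := {C.out}))
  have hint : ∫⁻ c', C.component η 0 c' ∂(C.stepKernel c) =
      C.stepKernel c {c | c.1 = C.out}ᶜ := by
    rw [← lintegral_indicator_one hO.compl]
    refine lintegral_congr fun c' => ?_
    by_cases h : c'.1 = C.out
    · simp [component_out η 0 h, h]
    · simp [component_zero_of_ne η h, h]
  rcases hδ with h0 | h0
  · obtain ⟨τ, hτ, hg, hr⟩ := exists_genTrans_integral_le c.2 hn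
    obtain ⟨j, hj, hlt⟩ := hη.ranked c.1 hout c.2 (hI.reachable c hc) τ hτ hg
    have hnonneg : ∀ i, ∀ᵐ c' ∂(C.stepKernel c), 0 ≤ η i c'.1 c'.2 := by
      intro i
      have hne : ∀ᵐ c' ∂(C.stepKernel c), c'.1 ≠ C.out := by
        rw [ae_iff]; simpa using h0
      filter_upwards [hne, ae_succ_stepMeasure c.2 hn] with c' hc' hs
      exact hη.nonneg c'.1 hc' c'.2 (hI.reachable c' (hc.succ hs)) i
    have key : ∀ (i : Fin n) (e : ℝ), 0 ≤ e → C.Ranked (η i) e c.2 τ → ∀ c',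
        (c, c') ∈ C.rankSet (C.component η i.succ) (ENNReal.ofReal e) := by
      intro i e he hri c'
      refine ⟨fun h => absurd h hn, fun _ => ?_⟩
      obtain ⟨h1, h2⟩ := hr (η i) e (hη.measurable i) hri
      change ∫⁻ c', C.component η i.succ c' ∂(C.stepKernel c) + _ ≤
        (C.component η i.succ c : ℝ≥0)
      calc _ ≤ ∫⁻ c', ENNReal.ofReal (η i c'.1 c'.2) ∂(C.stepKernel c) + ENNReal.ofReal e := by
            gcongr with c'
            exact ENNReal.coe_le_coe.2 (component_succ_le η i c')
        _ = ENNReal.ofReal (∫ c', η i c'.1 c'.2 ∂(C.stepKernel c) + e) := by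
            rw [ENNReal.ofReal_add (integral_nonneg_of_ae (hnonneg i)) he,
              ofReal_integral_eq_lintegral_ofReal (μ := C.stepKernel c) h1 (hnonneg i)]
        _ ≤ ENNReal.ofReal (η i c.1 c.2) := ENNReal.ofReal_le_ofReal (by
            have : ∫ c', η i c'.1 c'.2 ∂(C.stepKernel c) ≤ η i c.1 c.2 - e := h2
            linarith)
        _ = _ := by rw [component_succ_of_ne η i hout]; rfl
    refine ⟨j.succ, fun c' => mem_levelSet_succ (rankSet_anti _ hδε (key j ε hε hj c')) ?_
      fun i hi => ?_⟩
    · refine ⟨fun h => absurd h hn, fun _ => ?_⟩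
      simp only [hint, component_zero_of_ne η hout, add_zero]
      simpa using prob_le_one
    · simpa using key i 0 le_rfl (hlt i hi) c'
  · refine ⟨0, fun c' => mem_levelSet_zero ⟨fun h => absurd h hn, fun _ => ?_⟩⟩
    simp only [hint, component_zero_of_ne η hout]
    calc _ ≤ C.stepKernel c {c | c.1 = C.out}ᶜ + C.stepKernel c {c | c.1 = C.out} := by gcongr
      _ = _ := by
        rw [add_comm, measure_add_measure_compl hO]; simp

end Levels

/-! ### Runs under a scheduler -/

section Runs

variable {L : Type*} {m n : ℕ} [Fintype L] [MeasurableSpace L] [DiscreteMeasurableSpace L]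
  {C : PCFG L m}

lemma Scheduler.ae_succ_step (σ : C.Scheduler) {i : ℕ} {h : Hist L m i}
    (hp : C.IsFinitePath h) : ∀ᵐ c ∂(σ.step i h), C.Succ h.last c := by
  by_cases hn : (C.loc h.last.1).IsNondet
  · simpa [Scheduler.step, Kernel.piecewise_apply, hn] using σ.succ i h hp hn
  · have hs : σ.step i h = C.stepMeasure h.last.1 h.last.2 := by
      simp [Scheduler.step, Kernel.piecewise_apply, hn, stepKernel]
    rw [hs]
    exact ae_succ_stepMeasure h.last.2 hn

lemma Scheduler.ae_isFinitePath (σ : C.Scheduler) {x : Fin m → ℝ} (hx : x ∈ C.initVal) (i : ℕ) :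
    ∀ᵐ ρ ∂(σ.runMeasure x), C.IsFinitePath (i := i) (frestrictLe i ρ) := by
  induction i with
  | zero =>
    filter_upwards [ae_traj_zero (κ := σ.step) (h₀ := fun _ => (C.init, x))] with ρ hρ
    refine ⟨?_, ?_, fun k hk => absurd hk (by omega)⟩
    · simp [hρ]
    · simpa [hρ] using hx
  | succ i ih =>
    have hm : MeasurableSet {p : Hist L m i × Conf L m | C.Succ p.1.last p.2} :=
      (((measurable_last i).comp measurable_fst).prodMk measurable_snd) C.measurableSet_succ
    have hs := ae_traj_succ (κ := σ.step) (h₀ := fun _ => (C.init, x))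
      (Q := fun h c => C.Succ (Hist.last h) c) hm
      (ih.mono fun ρ hρ => σ.ae_succ_step hρ)
    filter_upwards [ih, hs] with ρ h1 h2
    exact IsFinitePath.succ_of_succ h1 h2

lemma Scheduler.ae_mem_levelSet (σ : C.Scheduler) {x : Fin m → ℝ} (hx : x ∈ C.initVal)
    {I : L → Set (Fin m → ℝ)} {η : Fin n → L → (Fin m → ℝ) → ℝ} {ε : ℝ}
    (hε : 0 ≤ ε) (hI : C.IsInvariantMap I) (hη : C.IsLexRSMMap I ε η) {δ : ℝ≥0∞} (hδ1 : δ ≤ 1)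
    (hδε : δ ≤ ENNReal.ofReal ε)
    (hδ : ∀ c : Conf L m, ¬ (C.loc c.1).IsNondet →
      C.stepKernel c {c | c.1 = C.out} = 0 ∨ δ ≤ C.stepKernel c {c | c.1 = C.out}) (i : ℕ) :
    ∀ᵐ ρ ∂(σ.runMeasure x), (ρ i).1 ≠ C.out → ∃ k, (ρ i, ρ (i + 1)) ∈ C.levelSet η δ k := by
  have hm : MeasurableSet {p : Hist L m i × Conf L m |
      p.1.last.1 ≠ C.out → ∃ k, (p.1.last, p.2) ∈ C.levelSet η δ k} := by
    refine MeasurableSet.imp ?_ ?_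
    · exact (measurable_fst.comp ((measurable_last i).comp measurable_fst))
        (MeasurableSet.of_discrete (s := {l : L | l ≠ C.out}))
    · simp only [Set.ofPred_exists]
      refine MeasurableSet.iUnion fun k => ?_
      exact (((measurable_last i).comp measurable_fst).prodMk measurable_snd)
        (measurableSet_levelSet hη.measurable δ k)
  refine ae_traj_succ (κ := σ.step) (h₀ := fun _ => (C.init, x)) (Q := fun h c =>
    (Hist.last h).1 ≠ C.out → ∃ k, (Hist.last h, c) ∈ C.levelSet η δ k) hm ?_
  filter_upwards [σ.ae_isFinitePath hx i] with ρ hp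
  filter_upwards [σ.ae_succ_step hp] with c hs hout
  have hr : C.Reachable (Hist.last (frestrictLe i ρ)) := ⟨i, _, hp, rfl⟩
  by_cases hn : (C.loc (Hist.last (frestrictLe i ρ)).1).IsNondet
  · exact mem_levelSet_of_succ hε hI hη hδ1 hδε hr hout hn hs
  · obtain ⟨k, hk⟩ := exists_mem_levelSet_of_not_isNondet hε hI hη hδε hr hout hn (hδ _ hn)
    exact ⟨k, hk c⟩

end Runs

end PCFG

theorem theorem2 {L : Type*} [Fintype L] [MeasurableSpace L] [DiscreteMeasurableSpace L]
    {m n : ℕ} (C : PCFG L m)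
    (h : ∃ ε : ℝ, 0 < ε ∧ ∃ (I : L → Set (Fin m → ℝ)) (η : Fin n → L → (Fin m → ℝ) → ℝ),
      C.IsInvariantMap I ∧ C.IsLexRSMMap I ε η) :
    C.TerminatesAlmostSurely := by
  obtain ⟨ε, hε, I, η, hI, hη⟩ := h
  obtain ⟨δ₀, hδ₀, hδ₀1, hδ₀out⟩ := C.exists_pos_le_stepMeasure_out
  set δ := min δ₀ (ENNReal.ofReal ε) with hδdef
  have hδ : δ ≠ 0 := (lt_min hδ₀ (ENNReal.ofReal_pos.2 hε)).ne'
  intro σ x hx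
  have : IsProbabilityMeasure (σ.runMeasure x) := by
    unfold PCFG.Scheduler.runMeasure; infer_instance
  have hlev : ∀ᵐ ρ ∂(σ.runMeasure x), ∀ i, (ρ i).1 ≠ C.out →
      ∃ k, (ρ i, ρ (i + 1)) ∈ C.levelSet η δ k :=
    ae_all_iff.2 fun i => σ.ae_mem_levelSet hx hε.le hI hη ((min_le_left _ _).trans hδ₀1)
      (min_le_right _ _)
      (fun c hn => (hδ₀out c.1 c.2 hn).imp_right fun h => (min_le_left _ _).trans h) i
  have hfin : ∀ᵐ ρ ∂(σ.runMeasure x), ∀ k,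
      (∀ᶠ i in atTop, (ρ i, ρ (i + 1)) ∈ C.rankSet (C.component η k) 0) →
        ∀ᶠ i in atTop, (ρ i, ρ (i + 1)) ∉ C.rankSet (C.component η k) δ :=
    ae_all_iff.2 fun k =>
      have hm := PCFG.measurable_component (C := C) hη.measurable k
      ae_eventually_notMem_of_lintegral_le (κ := σ.step) hm hδ
        (PCFG.measurableSet_rankSet hm 0) (PCFG.measurableSet_rankSet hm δ)
        (PCFG.lintegral_step_rankSet_le σ _ δ)
  suffices hT : ∀ᵐ ρ ∂(σ.runMeasure x), C.termTime ρ < ⊤ from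
    (measure_congr (eventuallyEq_univ.2 hT)).trans measure_univ
  filter_upwards [hlev, hfin] with ρ h1 h2
  by_cases hout : ∃ i, (ρ i).1 = C.out
  · obtain ⟨i, hi⟩ := hout
    exact (sInf_le ⟨i, hi, rfl⟩ : C.termTime ρ ≤ i).trans_lt (ENat.natCast_lt_top i)
  -- Otherwise every step has a level, but by induction each level occurs only finitely often.
  exfalso
  push Not at hout
  have hnot : ∀ k, ∀ᶠ i in atTop, (ρ i, ρ (i + 1)) ∉ C.levelSet η δ k := by
    intro k
    induction k using WellFoundedLT.induction with
    | ind k ih =>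
      have hlt : ∀ᶠ i in atTop, ∀ j : Fin (n + 1), j < k →
          (ρ i, ρ (i + 1)) ∉ C.levelSet η δ j := by
        refine eventually_all.2 fun j => ?_
        by_cases hj : j < k
        · exact (ih j hj).mono fun _ h _ => h
        · exact Eventually.of_forall fun _ h => absurd h hj
      refine (h2 k (hlt.mono fun i hi => ?_)).mono fun i hi hk => hi hk.1
      obtain ⟨j, hj⟩ := h1 i (hout i)
      rcases lt_trichotomy j k with hjk | rfl | hkj
      · exact absurd hj (hi j hjk)
      · exact PCFG.rankSet_anti _ bot_le hj.1
      · exact Set.mem_iInter₂.1 hj.2 k hkj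
  obtain ⟨i, hi⟩ := (eventually_all.2 hnot).exists
  obtain ⟨k, hk⟩ := h1 i (hout i)
  exact hi k hk
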